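/- **Nonconglomerability of bridged conformal prediction.** Let $\Omega=\mathbb{R}^\infty$ with the product Borel $\sigma$-field and coordinates $Y_1,Y_2,\dots$, and write $Y_{1:n}=(Y_1,\dots,Y_n)$. Let $\Pi(\cdot\mid\cdot)$ be a full conditional probability in the sense of de Finetti–Rényi on $\Omega$: for every nonempty event $C$, $\Pi(\cdot\mid C)$ is a finitely additive nonnegative set function on the events with $\Pi(C\mid C)=1$, and $\Pi(A\cap B\mid C)=\Pi(A\mid B\cap C)\,\Pi(B\mid C)$ whenever $B\cap C\neq\emptyset$. Write $\Pi(A)=\Pi(A\mid\Omega)$, and assume that $\Pi$ is exchangeable: for every $n$, every permutation $\sigma$ of $\{1,\dots,n\}$ and every Borel $C\subseteq\mathbb{R}^n$, $\Pi((Y_{\sigma(1)},\dots,Y_{\sigma(n)})\in C)=\Pi(Y_{1:n}\in C)$. Let $s:\mathbb{R}\to\mathbb{R}$ be a strictly increasing score, and for $y\in\mathbb{R}^n$ and $x\in\mathbb{R}$ let $$p(x;y)=\frac{1+\#\{i\le n: s(y_i)\ge s(x)\}}{n+1}$$ be the no-covariate conformal p-value. Its rank cells are the order-statistic cells $$I_k(y)=\Bigl\{x: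 p(x;y)=\tfrac{n-k+1}{n+1}\Bigr\}=(y_{(k)},y_{(k+1)}],\qquad k=0,\dots,n,$$ where $y_{(0)}=-\infty$, $y_{(n+1)}=+\infty$ and the last cell is $(y_{(n)},\infty)$. Suppose that the one-step predictive assessments of $\Pi$ agree with the $A_{(n)}$-bridged conformal mechanism for all $n\ge1$, that is, for every $n\ge 1$ and $k\in\{0,\dots,n\}$, $$\Pi\bigl(Y_{n+1}\in I_k(Y_{1:n})\bigm| Y_{1:n}\bigr)=\frac1{n+1}\quad\text{a.s.},$$ meaning that $\Pi(Y_{n+1}\in I_k(Y_{1:n})\mid Y_{1:n}\in C)=\frac1{n+1}$ for every Borel $C\subseteq\mathbb{R}^n$ with $\Pi(Y_{1:n}\in C)>0$. Then $\Pi$ is not conglomerable and admits a Dutch book: there are an event $B$ and a countable measurable partition $\{A_m\}_{m\ge1}$ of $\Omega$ with $\Pi(A_m)>0$ for all $m$ such that $$\Pi(B)<\inf_{m\ge1}\Pi(B\mid A_m)$$ (so that $\inf_m\Pi(B'\mid A_m)\le\Pi(B')\le\sup_m\Pi(B'\mid A_m)$ does not hold for all events $B'$), and there is a Dutch book along $\{A_m\}$.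 Here a bet on an event $E$ given an event $F$ with price $q$ and signed stake $t$ pays the agent $t\,\mathbf 1_F(\mathbf 1_E-q)$, and is strictly favourable if $t\,(\Pi(E\mid F)-q)>0$. A Dutch book along $\{A_m\}$ consists of finitely many bets given $\Omega$ together with one bet given $A_m$ for each $m$, the latter with uniformly bounded payoffs, all of them strictly favourable, whose total payoff is at most $-\varepsilon$ at every point of $\Omega$, for some fixed $\varepsilon>0$. -/

import Mathlib

/-- A full conditional probability in the sense of de Finetti, Rényi and Dubins on the measurable
space `Ω`: a real number `cond A B` (the probability of `A` given `B`) for every event `A` and every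
nonempty event `B`, finitely additive in `A`, normalised, and satisfying the multiplication rule.
The conditioning event may have probability zero.  Values at non-measurable sets, or at `B = ∅`,
carry no meaning and are not constrained. -/
structure FullCondProb (Ω : Type*) [MeasurableSpace Ω] where
  cond : Set Ω → Set Ω → ℝ
  nonneg : ∀ A B : Set Ω, MeasurableSet A → MeasurableSet B → B.Nonempty → 0 ≤ cond A B
  self : ∀ B : Set Ω, MeasurableSet B → B.Nonempty → cond B B = 1
  add : ∀ A A' B : Set Ω, MeasurableSet A → MeasurableSet A' → MeasurableSet B → B.Nonempty →
    Disjoint A A' → cond (A ∪ A') B = cond A B + cond A' B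
  mul : ∀ A B C : Set Ω, MeasurableSet A → MeasurableSet B → MeasurableSet C → (B ∩ C).Nonempty →
    cond (A ∩ B) C = cond A (B ∩ C) * cond B C

/-- A bet on the event `event`, called off unless the event `given` occurs, with unit price `price`
and (signed) stake `stake`. -/
structure CondBet (Ω : Type*) where
  event : Set Ω
  given : Set Ω
  price : ℝ
  stake : ℝ

/-- The net payoff to the agent who accepts the bet: `stake * 1_given * (1_event - price)`. -/
noncomputable def CondBet.payoff {Ω : Type*} (b : CondBet Ω) (ω : Ω) : ℝ :=
  b.stake * b.given.indicator (fun ω' => b.event.indicator (fun _ => (1 : ℝ)) ω' - b.price) ω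

/-- `A 0, A 1, …` is a countable measurable partition of `Ω`. -/
structure IsCountablePartition {Ω : Type*} [MeasurableSpace Ω] (A : ℕ → Set Ω) : Prop where
  measurable : ∀ m, MeasurableSet (A m)
  disjoint : ∀ m m', m ≠ m' → Disjoint (A m) (A m')
  cover : ⋃ m, A m = Set.univ

/-- The initial segment `(Y₁, …, Yₙ)` of a real sequence; the observation `Y_{i+1}` is `ω i`. -/
def initSeg (n : ℕ) (ω : ℕ → ℝ) : Fin n → ℝ := fun i => ω i

/-- The order statistics `y₍₁₎ ≤ … ≤ y₍ₙ₎` of `y ∈ ℝⁿ`, with `y₍₀₎ = -∞` and `y₍ₖ₎ = +∞` for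
`k > n`. -/
noncomputable def orderStat {n : ℕ} (y : Fin n → ℝ) : ℕ → EReal
  | 0 => ⊥
  | k + 1 => if h : k < n then ((y (Tuple.sort y ⟨k, h⟩) : ℝ) : EReal) else ⊤

/-- The order-statistic cell `I_k(y) = (y₍ₖ₎, y₍ₖ₊₁₎]`, for `k = 0, …, n`. -/
def gapCell {n : ℕ} (y : Fin n → ℝ) (k : Fin (n + 1)) : Set ℝ :=
  {x | orderStat y k < (x : EReal) ∧ (x : EReal) ≤ orderStat y (k + 1)}

open Classical in
/-- The full conformal p-value (no covariates) of the candidate value `x` for `Y_{n+1}`, given the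
data `y ∈ ℝⁿ` and the score `s`: the proportion of the `n + 1` augmented scores that are at least
the score of `x`. -/
noncomputable def conformalPValue (s : ℝ → ℝ) {n : ℕ} (y : Fin n → ℝ) (x : ℝ) : ℝ :=
  ((Finset.univ.filter
    (fun i : Fin (n + 1) => s x ≤ s (Fin.snoc (α := fun _ => ℝ) y x i))).card : ℝ) / (n + 1)

/-- The `k`-th rank cell of the conformal p-value: the candidates whose p-value is
`(n - k + 1) / (n + 1)`.  For a strictly increasing score it is the order-statistic cell
`I_k(y) = (y₍ₖ₎, y₍ₖ₊₁₎]`, see `conformalCell_eq_gapCell`. -/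
def conformalCell (s : ℝ → ℝ) {n : ℕ} (y : Fin n → ℝ) (k : Fin (n + 1)) : Set ℝ :=
  {x | conformalPValue s y x = ((n : ℝ) - (k : ℕ) + 1) / (n + 1)}

namespace FullCondProb

/-- The unconditional (finitely additive) law `P(A) = P(A | Ω)`. -/
def prob {Ω : Type*} [MeasurableSpace Ω] (P : FullCondProb Ω) (A : Set Ω) : ℝ :=
  P.cond A Set.univ

/-- `P` is conglomerable along the partition `A`. -/
def ConglomerableAlong {Ω : Type*} [MeasurableSpace Ω] (P : FullCondProb Ω) (A : ℕ → Set Ω) :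
    Prop :=
  ∀ B : Set Ω, MeasurableSet B → (⨅ m, P.cond B (A m)) ≤ P.prob B ∧
    P.prob B ≤ ⨆ m, P.cond B (A m)

/-- The bet is strictly favourable to the agent whose (conditional) betting rates are given by
`P`. -/
def Favourable {Ω : Type*} [MeasurableSpace Ω] (P : FullCondProb Ω) (b : CondBet Ω) : Prop :=
  MeasurableSet b.event ∧ MeasurableSet b.given ∧ b.given.Nonempty ∧
    0 < b.stake * (P.cond b.event b.given - b.price)

/-- `P` admits a countable Dutch book along the partition `A`: there are finitely many
unconditional bets `u i` and, for each cell `A m`, a bet `v m` that is called off unless `A m`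
occurs, with uniformly bounded payoffs, such that each bet is strictly favourable at the
corresponding assessment of `P` while the total payoff is a loss of at least a fixed `ε > 0`
at every point. -/
def DutchBookAlong {Ω : Type*} [MeasurableSpace Ω] (P : FullCondProb Ω) (A : ℕ → Set Ω) : Prop :=
  ∃ (r : ℕ) (u : Fin r → CondBet Ω) (v : ℕ → CondBet Ω),
    (∀ i, (u i).given = Set.univ ∧ P.Favourable (u i)) ∧
    (∀ m, (v m).given = A m ∧ P.Favourable (v m)) ∧
    (∃ M : ℝ, ∀ m ω, |(v m).payoff ω| ≤ M) ∧
    ∃ ε : ℝ, 0 < ε ∧ ∀ ω, ∃ t : ℝ, HasSum (fun m => (v m).payoff ω) t ∧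
      (∑ i, (u i).payoff ω) + t ≤ -ε

/-- Exchangeability: for each `n` the law of `(Y₁, …, Yₙ)` is invariant under permutations. -/
def Exchangeable (P : FullCondProb (ℕ → ℝ)) : Prop :=
  ∀ (n : ℕ) (σ : Equiv.Perm (Fin n)) (C : Set (Fin n → ℝ)), MeasurableSet C →
    P.prob {ω | (fun i => initSeg n ω (σ i)) ∈ C} = P.prob {ω | initSeg n ω ∈ C}

/-- The one-step predictive assessments at stage `n` agree with the `A₍ₙ₎`-bridged conformal
mechanism with score `s`: `P(Y_{n+1} ∈ I_k(Y_{1:n}) | Y_{1:n}) = 1 / (n + 1)` almost surely for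
`k = 0, …, n`, i.e. the conditional probability of this event given `Y_{1:n} ∈ C` is `1 / (n + 1)`
for each event `{Y_{1:n} ∈ C}` of positive probability. -/
def AgreesWithBridgedConformal (P : FullCondProb (ℕ → ℝ)) (s : ℝ → ℝ) (n : ℕ) : Prop :=
  ∀ (k : Fin (n + 1)) (C : Set (Fin n → ℝ)), MeasurableSet C →
    0 < P.prob {ω | initSeg n ω ∈ C} →
    P.cond {ω | ω n ∈ conformalCell s (initSeg n ω) k} {ω | initSeg n ω ∈ C} = 1 / ((n : ℝ) + 1)

end FullCondProb

/-- For a strictly increasing score the conformal rank cells are the order-statistic cells. -/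
theorem conformalCell_eq_gapCell {s : ℝ → ℝ} (hs : StrictMono s) {n : ℕ} (y : Fin n → ℝ)
    (k : Fin (n + 1)) : conformalCell s y k = gapCell y k := by
  classical
  obtain ⟨k, hk⟩ := k
  have hmono : Monotone (y ∘ Tuple.sort y) := Tuple.monotone_sort y
  ext x
  -- reduce the p-value to a count over the sorted sample
  have hcard : conformalPValue s y x =
      (((Finset.univ.filter (fun i : Fin n => x ≤ y (Tuple.sort y i))).card : ℝ) + 1) / (n + 1) := by
    unfold conformalPValue
    congr 1
    rw [← Nat.cast_succ]
    congr 1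
    rw [Finset.card_filter, Fin.sum_univ_castSucc, Finset.card_filter]
    simp only [Fin.snoc_castSucc, Fin.snoc_last, le_refl, if_true, hs.le_iff_le]
    rw [Nat.succ_eq_add_one]
    congr 1
    exact (Equiv.sum_comp (Tuple.sort y) (fun i => if x ≤ y i then 1 else 0)).symm
  set c := (Finset.univ.filter (fun i : Fin n => x ≤ y (Tuple.sort y i))).card with hc
  have hn : ((n : ℝ) + 1) ≠ 0 := by positivity
  have h1 : x ∈ conformalCell s y ⟨k, hk⟩ ↔ c + k = n := by
    simp only [conformalCell, Set.mem_ofPred_eq, hcard]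
    rw [div_left_inj' hn]
    constructor
    · intro h
      have : (c : ℝ) + k = n := by linarith
      exact_mod_cast this
    · intro h
      have : (c : ℝ) + k = n := by exact_mod_cast h
      linarith
  rw [h1]
  -- the count of sample points below `x`
  set d := (Finset.univ.filter (fun i : Fin n => y (Tuple.sort y i) < x)).card with hd
  have hcd : d + c = n := by
    have := Finset.card_filter_add_card_filter_not (s := (Finset.univ : Finset (Fin n)))
      (fun i : Fin n => y (Tuple.sort y i) < x)
    simpa [hd, hc, not_lt] using this
  have hdlow : ∀ j : ℕ, ∀ hj : j < n, (y (Tuple.sort y ⟨j, hj⟩) < x ↔ j < d) := by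
    intro j hj
    constructor
    · intro h
      have hsub : Finset.Iic (⟨j, hj⟩ : Fin n) ⊆
          Finset.univ.filter (fun i : Fin n => y (Tuple.sort y i) < x) := by
        intro i hi
        simp only [Finset.mem_filter, Finset.mem_univ, true_and]
        exact lt_of_le_of_lt (hmono (Finset.mem_Iic.mp hi)) h
      have := Finset.card_le_card hsub
      rw [Fin.card_Iic] at this
      simp only at this
      omega
    · intro h
      by_contra hx
      push Not at hx
      have hsub : Finset.univ.filter (fun i : Fin n => y (Tuple.sort y i) < x) ⊆
          Finset.Iio (⟨j, hj⟩ : Fin n) := by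
        intro i hi
        simp only [Finset.mem_filter, Finset.mem_univ, true_and] at hi
        rw [Finset.mem_Iio]
        by_contra hij
        push Not at hij
        exact absurd (lt_of_le_of_lt (hx.trans (hmono hij)) hi) (lt_irrefl _)
      have := Finset.card_le_card hsub
      rw [Fin.card_Iio] at this
      simp only at this
      omega
  have hlow : orderStat y k < (x : EReal) ↔ k ≤ d := by
    cases k with
    | zero => simp [orderStat]
    | succ j =>
      have hj : j < n := by omega
      simp only [orderStat, hj, dif_pos, EReal.coe_lt_coe_iff]
      rw [hdlow j hj]
      omega
  have hup : (x : EReal) ≤ orderStat y (k + 1) ↔ d ≤ k := by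
    by_cases hkn : k < n
    · simp only [orderStat, hkn, dif_pos, EReal.coe_le_coe_iff]
      rw [← not_lt, hdlow k hkn, not_lt]
    · simp only [orderStat, hkn, dif_neg, not_false_eq_true, le_top, true_iff]
      omega
  simp only [gapCell, Set.mem_ofPred_eq, hlow, hup]
  omega

/-!
The event witnessing the failure of conglomerability is the ascent `B = {Y₁ < Y₂}`, of probability
`1 / 2` by the bridge at `n = 1`.

The bridge and exchangeability make the observations cluster infinitely closely. Comparing the two
ways of computing `P(Y₁ < Y₂, Y₁ ≤ a)` -- as `P(Y₁ ≤ a) / 2` by the bridge, and by splitting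
according to `Y₂ ≤ a` or `a < Y₂` and using the symmetry of `(Y₁, Y₂)` -- one gets
`P(Y₁ ≤ a < Y₂) = 0` for every real `a` (`FullCondProb.prob_separated`). Also `P(Y₁ = Y₂) = 0`. As
two distinct reals are separated by a member of a fixed dense sequence, the complement of `B`,
although of probability `1 / 2`, is a countable union of null events.

The event `B` itself is cut into countably many events of positive probability by the length of the
initial increasing run: by the bridge for the top cell, each further observation exceeds all earlier
ones with conditional probability `1 / (n + 1)`, which is neither `0` nor `1`
(`FullCondProb.prob_increasingRun_succ`).

Attaching one null piece of `Bᶜ` to each piece of `B` gives a partition whose cells all have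
positive probability and satisfy `P(B | A m) = 1`, whereas `P(B) = 1 / 2`. Selling `B` at a price
above `1 / 2` and buying it back, given the cell, at a higher price below `1` is a sure loss.
-/

open Set

/-! ### Finitely additive probability -/

namespace FullCondProb

section Basic

variable {Ω : Type*} [MeasurableSpace Ω] (P : FullCondProb Ω) {A B : Set Ω}

theorem prob_inter_eq_mul (hA : MeasurableSet A) (hB : MeasurableSet B) (hne : B.Nonempty) :
    P.prob (A ∩ B) = P.cond A B * P.prob B := by
  have h := P.mul A B univ hA hB .univ (by simpa using hne)
  rwa [inter_univ] at h

variable [Nonempty Ω]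

theorem prob_nonneg (hA : MeasurableSet A) : 0 ≤ P.prob A :=
  P.nonneg A univ hA .univ univ_nonempty

theorem prob_univ : P.prob univ = 1 := P.self univ .univ univ_nonempty

theorem prob_union (hA : MeasurableSet A) (hB : MeasurableSet B) (h : Disjoint A B) :
    P.prob (A ∪ B) = P.prob A + P.prob B :=
  P.add A B univ hA hB .univ univ_nonempty h

theorem prob_empty : P.prob ∅ = 0 := by
  have h := P.prob_union .empty .empty (disjoint_empty (∅ : Set Ω))
  rw [union_self] at h
  linarith

theorem nonempty_of_prob_pos (h : 0 < P.prob A) : A.Nonempty := by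
  rw [nonempty_iff_ne_empty]
  rintro rfl
  exact h.ne' P.prob_empty

theorem prob_inter_add_sdiff (hA : MeasurableSet A) (hB : MeasurableSet B) :
    P.prob (A ∩ B) + P.prob (A \ B) = P.prob A := by
  rw [← P.prob_union (hA.inter hB) (hA.diff hB) disjoint_inf_sdiff, inter_union_sdiff]

theorem prob_mono (hA : MeasurableSet A) (hB : MeasurableSet B) (h : A ⊆ B) :
    P.prob A ≤ P.prob B := by
  have h1 := P.prob_inter_add_sdiff hB hA
  rw [inter_eq_self_of_subset_right h] at h1
  linarith [P.prob_nonneg (hB.diff hA)]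

theorem cond_eq_one_of_prob_sdiff_eq_zero (hA : MeasurableSet A) (hB : MeasurableSet B)
    (hpos : 0 < P.prob B) (h : P.prob (B \ A) = 0) : P.cond A B = 1 := by
  have h1 := P.prob_inter_eq_mul hA hB (P.nonempty_of_prob_pos hpos)
  have h2 := P.prob_inter_add_sdiff hB hA
  rw [inter_comm, h1, h, add_zero] at h2
  exact mul_right_cancel₀ hpos.ne' (by rw [h2, one_mul])

end Basic

/-! ### A Dutch book from an event that is almost sure on every cell -/

/-- An event of probability `1 / 2` which has conditional probability `1` on every cell of a
partition is sold at `5 / 8` and bought back given each cell at `7 / 8`, for a net loss of `1 / 4`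
whatever happens. -/
theorem dutchBookAlong_of_cond_eq_one {Ω : Type*} [MeasurableSpace Ω] (P : FullCondProb Ω)
    {B : Set Ω} {A : ℕ → Set Ω} (hB : MeasurableSet B) (hA : IsCountablePartition A)
    (hne : ∀ m, (A m).Nonempty) (hPB : P.prob B = 1 / 2) (hcond : ∀ m, P.cond B (A m) = 1) :
    P.DutchBookAlong A := by
  classical
  refine ⟨1, fun _ => ⟨B, univ, 5 / 8, -1⟩, fun m => ⟨B, A m, 7 / 8, 1⟩, ?_, ?_, ⟨1, ?_⟩,
    1 / 4, by norm_num, ?_⟩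
  · refine fun _ => ⟨rfl, hB, .univ, (hne 0).mono (subset_univ _), ?_⟩
    change 0 < (-1) * (P.prob B - 5 / 8)
    rw [hPB]
    norm_num
  · refine fun m => ⟨rfl, hB, hA.measurable m, hne m, ?_⟩
    simp only [hcond]
    norm_num
  · intro m ω
    by_cases h1 : ω ∈ A m <;> by_cases h2 : ω ∈ B <;> simp [CondBet.payoff, h1, h2] <;>
      norm_num [abs_le]
  · intro ω
    obtain ⟨m, hm⟩ := mem_iUnion.mp (hA.cover.symm ▸ mem_univ ω : ω ∈ ⋃ m, A m)
    refine ⟨_, hasSum_single m fun m' hm' => ?_, ?_⟩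
    · have : ω ∉ A m' := fun h => disjoint_left.mp (hA.disjoint m' m hm') h hm
      simp [CondBet.payoff, this]
    · by_cases h2 : ω ∈ B <;> simp [CondBet.payoff, hm, h2] <;> norm_num

end FullCondProb

/-! ### Records and increasing runs -/

/-- The top cell `(y₍ₙ₎, ∞)` consists of the values exceeding the whole sample. -/
theorem mem_conformalCell_last {s : ℝ → ℝ} (hs : StrictMono s) {n : ℕ} (y : Fin n → ℝ) (x : ℝ) :
    x ∈ conformalCell s y (Fin.last n) ↔ ∀ i, y i < x := by
  rw [conformalCell_eq_gapCell hs]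
  cases n with
  | zero => simp [gapCell, orderStat]
  | succ j =>
    simp only [gapCell, orderStat, Fin.val_last, mem_ofPred_eq, lt_add_iff_pos_right, zero_lt_one,
      dite_true, lt_irrefl, dite_false, le_top, and_true, EReal.coe_lt_coe_iff]
    refine ⟨fun h i => ?_, fun h => h _⟩
    refine lt_of_le_of_lt ?_ h
    have := Tuple.monotone_sort y (Fin.le_last ((Tuple.sort y).symm i))
    rwa [Function.comp_apply, Equiv.apply_symm_apply] at this

/-- The event that the first `n + 1` observations are strictly increasing. -/
def increasingRun (n : ℕ) : Set (ℕ → ℝ) := {ω | ∀ i < n, ω i < ω (i + 1)}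

theorem increasingRun_anti : Antitone increasingRun :=
  fun _ _ h _ hω i hi => hω i (hi.trans_le h)

theorem measurableSet_increasingRun (n : ℕ) : MeasurableSet (increasingRun n) := by
  have : increasingRun n = ⋂ i, ⋂ (_ : i < n), {ω : ℕ → ℝ | ω i < ω (i + 1)} := by
    ext ω
    simp [increasingRun]
  rw [this]
  exact .iInter fun i => .iInter fun _ =>
    measurableSet_lt (measurable_pi_apply i) (measurable_pi_apply (i + 1))

theorem increasingRun_eq_initSeg (n : ℕ) :
    increasingRun n =
      {ω | initSeg (n + 1) ω ∈ {y : Fin (n + 1) → ℝ | ∀ i : Fin n, y i.castSucc < y i.succ}} := by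
  ext ω
  exact ⟨fun h i => h i i.2, fun h i hi => h ⟨i, hi⟩⟩

/-- A run is prolonged exactly when the next observation exceeds all earlier ones. -/
theorem increasingRun_succ (n : ℕ) :
    increasingRun (n + 1) = {ω | ∀ i : Fin (n + 1), ω i < ω (n + 1)} ∩ increasingRun n := by
  ext ω
  constructor
  · refine fun h => ⟨fun i => ?_, increasingRun_anti n.le_succ h⟩
    have key : ∀ j ≤ n + 1, ∀ i < j, ω i < ω j := by
      intro j
      induction j with
      | zero => intro _ i hi; omega
      | succ j ih =>
        intro hj i hi
        rcases Nat.lt_succ_iff_lt_or_eq.mp hi with hi | rfl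
        · exact (ih (by omega) i hi).trans (h j hj)
        · exact h i hj
    exact key _ le_rfl i i.2
  · rintro ⟨h1, h2⟩ i hi
    rcases Nat.lt_succ_iff_lt_or_eq.mp hi with hi | rfl
    · exact h2 i hi
    · exact h1 (Fin.last i)

namespace FullCondProb

variable {P : FullCondProb (ℕ → ℝ)} {s : ℝ → ℝ}

theorem measurableSet_record (n : ℕ) :
    MeasurableSet {ω : ℕ → ℝ | ∀ i : Fin n, ω i < ω n} := by
  rw [ofPred_forall]
  exact .iInter fun i => measurableSet_lt (measurable_pi_apply _) (measurable_pi_apply _)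

/-- Under the bridge, the next observation is a record with conditional probability
`1 / (n + 1)` given any event about the first `n`. -/
theorem AgreesWithBridgedConformal.prob_record_inter {n : ℕ}
    (h : P.AgreesWithBridgedConformal s n) (hs : StrictMono s) {C : Set (Fin n → ℝ)}
    (hC : MeasurableSet C) :
    P.prob ({ω | ∀ i : Fin n, ω i < ω n} ∩ {ω | initSeg n ω ∈ C}) =
      P.prob {ω | initSeg n ω ∈ C} / (n + 1) := by
  have hmeas : MeasurableSet {ω | initSeg n ω ∈ C} :=
    measurable_pi_lambda (initSeg n) (fun i => measurable_pi_apply (i : ℕ)) hC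
  have hrec := measurableSet_record n
  rcases (P.prob_nonneg hmeas).eq_or_lt with h0 | hpos
  · rw [← h0, zero_div]
    refine le_antisymm ?_ (P.prob_nonneg (hrec.inter hmeas))
    exact (P.prob_mono (hrec.inter hmeas) hmeas inter_subset_right).trans h0.ge
  · have h1 := h (Fin.last n) C hC hpos
    have h2 : {ω : ℕ → ℝ | ω n ∈ conformalCell s (initSeg n ω) (Fin.last n)} =
        {ω | ∀ i : Fin n, ω i < ω n} := by
      ext ω
      exact mem_conformalCell_last hs _ _
    rw [h2] at h1
    rw [P.prob_inter_eq_mul hrec hmeas (P.nonempty_of_prob_pos hpos), h1]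
    ring

theorem prob_increasingRun_succ (hs : StrictMono s)
    (hbridge : ∀ n : ℕ, 1 ≤ n → P.AgreesWithBridgedConformal s n) (n : ℕ) :
    P.prob (increasingRun (n + 1)) = P.prob (increasingRun n) / (n + 2) := by
  have hC : MeasurableSet {y : Fin (n + 1) → ℝ | ∀ i : Fin n, y i.castSucc < y i.succ} := by
    rw [ofPred_forall]
    exact .iInter fun i => measurableSet_lt (measurable_pi_apply _) (measurable_pi_apply _)
  have h := (hbridge (n + 1) (by omega)).prob_record_inter hs hC
  rw [← increasingRun_eq_initSeg, ← increasingRun_succ] at h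
  rw [h]
  push_cast
  ring

theorem prob_increasingRun_zero : P.prob (increasingRun 0) = 1 := by
  have : increasingRun 0 = univ := by
    ext ω
    simp [increasingRun]
  rw [this, P.prob_univ]

theorem prob_increasingRun_pos (hs : StrictMono s)
    (hbridge : ∀ n : ℕ, 1 ≤ n → P.AgreesWithBridgedConformal s n) (n : ℕ) :
    0 < P.prob (increasingRun n) := by
  induction n with
  | zero => rw [prob_increasingRun_zero]; exact one_pos
  | succ n ih => rw [prob_increasingRun_succ hs hbridge]; positivity

theorem prob_increasingRun_sdiff_pos (hs : StrictMono s)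
    (hbridge : ∀ n : ℕ, 1 ≤ n → P.AgreesWithBridgedConformal s n) (n : ℕ) :
    0 < P.prob (increasingRun n \ increasingRun (n + 1)) := by
  have h := P.prob_inter_add_sdiff (measurableSet_increasingRun n)
    (measurableSet_increasingRun (n + 1))
  rw [inter_eq_self_of_subset_right (increasingRun_anti n.le_succ),
    prob_increasingRun_succ hs hbridge] at h
  have hlt : P.prob (increasingRun n) / (n + 2) < P.prob (increasingRun n) :=
    div_lt_self (prob_increasingRun_pos hs hbridge n) (by linarith [n.cast_nonneg (α := ℝ)])
  linarith

/-! ### Clustering of the observations -/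

theorem Exchangeable.prob_swap (hexch : P.Exchangeable) {C : Set (ℝ × ℝ)} (hC : MeasurableSet C) :
    P.prob {ω | (ω 1, ω 0) ∈ C} = P.prob {ω | (ω 0, ω 1) ∈ C} := by
  have hm : MeasurableSet {y : Fin 2 → ℝ | (y 0, y 1) ∈ C} :=
    ((measurable_pi_apply 0).prodMk (measurable_pi_apply 1)) hC
  simpa [initSeg] using hexch 2 (Equiv.swap 0 1) _ hm

theorem increasingRun_one : increasingRun 1 = {ω | ω 0 < ω 1} := by
  ext ω
  simp [increasingRun]

theorem prob_ascent (hs : StrictMono s)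
    (hbridge : ∀ n : ℕ, 1 ≤ n → P.AgreesWithBridgedConformal s n) :
    P.prob {ω | ω 0 < ω 1} = 1 / 2 := by
  rw [← increasingRun_one, prob_increasingRun_succ hs hbridge, prob_increasingRun_zero]
  norm_num

/-- Events about the first two observations are measurable. -/
theorem measurableSet_firstTwo {C : Set (ℝ × ℝ)} (hC : MeasurableSet C) :
    MeasurableSet {ω : ℕ → ℝ | (ω 0, ω 1) ∈ C} :=
  ((measurable_pi_apply 0).prodMk (measurable_pi_apply 1)) hC

theorem prob_tie (hexch : P.Exchangeable) (hs : StrictMono s)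
    (hbridge : ∀ n : ℕ, 1 ≤ n → P.AgreesWithBridgedConformal s n) :
    P.prob {ω | ω 0 = ω 1} = 0 := by
  have hlt : MeasurableSet {z : ℝ × ℝ | z.1 < z.2} := measurableSet_lt measurable_fst measurable_snd
  have hgt : MeasurableSet {z : ℝ × ℝ | z.2 < z.1} := measurableSet_lt measurable_snd measurable_fst
  have heq : MeasurableSet {z : ℝ × ℝ | z.1 = z.2} :=
    measurableSet_eq_fun measurable_fst measurable_snd
  have h1 : P.prob {ω | ω 0 < ω 1} = 1 / 2 := prob_ascent hs hbridge
  have h2 : P.prob {ω | ω 1 < ω 0} = P.prob {ω | ω 0 < ω 1} := hexch.prob_swap hlt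
  have h3 := P.prob_union (measurableSet_firstTwo hlt) (measurableSet_firstTwo hgt)
    (disjoint_left.mpr fun ω (h : ω 0 < ω 1) (h' : ω 1 < ω 0) => h.not_gt h')
  have h4 := P.prob_union ((measurableSet_firstTwo hlt).union (measurableSet_firstTwo hgt))
    (measurableSet_firstTwo heq) (disjoint_left.mpr (by
      rintro ω (h | h) (h' : ω 0 = ω 1)
      · exact (show ω 0 < ω 1 from h).ne h'
      · exact (show ω 1 < ω 0 from h).ne' h'))
  have h5 : ({ω : ℕ → ℝ | (ω 0, ω 1) ∈ {z : ℝ × ℝ | z.1 < z.2}} ∪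
      {ω | (ω 0, ω 1) ∈ {z : ℝ × ℝ | z.2 < z.1}}) ∪
      {ω | (ω 0, ω 1) ∈ {z : ℝ × ℝ | z.1 = z.2}} = univ := by
    ext ω
    rcases lt_trichotomy (ω 0) (ω 1) with h | h | h <;> simp [h]
  rw [h5, P.prob_univ, h3] at h4
  simp only [mem_ofPred_eq] at h4
  linarith

/-- No real number separates the first two observations with positive probability. With
`x = P(Y₁ ≤ a < Y₂)` and `z = P(Y₁ < Y₂ ≤ a)`, symmetry and the absence of ties give
`P(Y₁ ≤ a) = x + 2 z`, while the bridge gives `P(Y₁ ≤ a) = 2 (x + z)`. -/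
theorem prob_separated (hexch : P.Exchangeable) (hs : StrictMono s)
    (hbridge : ∀ n : ℕ, 1 ≤ n → P.AgreesWithBridgedConformal s n) (a : ℝ) :
    P.prob {ω | ω 1 ≤ a ∧ a < ω 0} = 0 := by
  have hlt : MeasurableSet {z : ℝ × ℝ | z.1 < z.2} := measurableSet_lt measurable_fst measurable_snd
  have hfst : MeasurableSet {z : ℝ × ℝ | z.1 ≤ a} := measurableSet_le measurable_fst measurable_const
  have hsnd : MeasurableSet {z : ℝ × ℝ | z.2 ≤ a} := measurableSet_le measurable_snd measurable_const
  have hsep : MeasurableSet {z : ℝ × ℝ | z.1 ≤ a ∧ a < z.2} :=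
    hfst.inter (measurableSet_lt measurable_const measurable_snd)
  have hasc : MeasurableSet {z : ℝ × ℝ | z.1 < z.2 ∧ z.2 ≤ a} := hlt.inter hsnd
  have mE : MeasurableSet {ω : ℕ → ℝ | ω 0 ≤ a} := measurableSet_firstTwo hfst
  have mF : MeasurableSet {ω : ℕ → ℝ | ω 1 ≤ a} := measurableSet_firstTwo hsnd
  have mL : MeasurableSet {ω : ℕ → ℝ | ω 0 < ω 1} := measurableSet_firstTwo hlt
  have mT : MeasurableSet {ω : ℕ → ℝ | ω 0 = ω 1} :=
    measurableSet_firstTwo (measurableSet_eq_fun measurable_fst measurable_snd)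
  have hswapx : P.prob {ω | ω 1 ≤ a ∧ a < ω 0} = P.prob {ω | ω 0 ≤ a ∧ a < ω 1} :=
    hexch.prob_swap hsep
  have hswapz : P.prob {ω | ω 1 < ω 0 ∧ ω 0 ≤ a} = P.prob {ω | ω 0 < ω 1 ∧ ω 1 ≤ a} :=
    hexch.prob_swap hasc
  have hbr : P.prob ({ω | ω 0 < ω 1} ∩ {ω | ω 0 ≤ a}) = P.prob {ω | ω 0 ≤ a} / 2 := by
    have hC : MeasurableSet {y : Fin 1 → ℝ | y 0 ≤ a} :=
      measurableSet_le (measurable_pi_apply _) measurable_const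
    have h := (hbridge 1 le_rfl).prob_record_inter hs hC
    simp only [Fin.forall_fin_one, initSeg, Fin.val_zero, mem_ofPred_eq] at h
    rw [h]
    norm_num
  -- `{Y₁ < Y₂, Y₁ ≤ a}` is split according to the side of `a` on which `Y₂` falls.
  have h1 := P.prob_inter_add_sdiff (mL.inter mE) mF
  have e1 : ({ω : ℕ → ℝ | ω 0 < ω 1} ∩ {ω | ω 0 ≤ a}) ∩ {ω | ω 1 ≤ a} =
      {ω | ω 0 < ω 1 ∧ ω 1 ≤ a} := by
    ext ω
    exact ⟨fun h => ⟨h.1.1, h.2⟩, fun h => ⟨⟨h.1, h.1.le.trans h.2⟩, h.2⟩⟩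
  have e2 : ({ω : ℕ → ℝ | ω 0 < ω 1} ∩ {ω | ω 0 ≤ a}) \ {ω | ω 1 ≤ a} =
      {ω | ω 0 ≤ a ∧ a < ω 1} := by
    ext ω
    exact ⟨fun h => ⟨h.1.2, not_le.mp h.2⟩,
      fun h => ⟨⟨h.1.trans_lt h.2, h.1⟩, not_le.mpr h.2⟩⟩
  rw [e1, e2, hbr] at h1
  -- `{Y₁ ≤ a}` is split in the same way, and `{Y₁ ≤ a, Y₂ ≤ a}` according to the order.
  have h2 := P.prob_inter_add_sdiff mE mF
  have e3 : {ω : ℕ → ℝ | ω 0 ≤ a} \ {ω | ω 1 ≤ a} = {ω | ω 0 ≤ a ∧ a < ω 1} := by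
    ext ω
    exact ⟨fun h => ⟨h.1, not_le.mp h.2⟩, fun h => ⟨h.1, not_le.mpr h.2⟩⟩
  have h3 := P.prob_inter_add_sdiff (mE.inter mF) mL
  have e4 : ({ω : ℕ → ℝ | ω 0 ≤ a} ∩ {ω | ω 1 ≤ a}) ∩ {ω | ω 0 < ω 1} =
      {ω | ω 0 < ω 1 ∧ ω 1 ≤ a} := by
    ext ω
    exact ⟨fun h => ⟨h.2, h.1.2⟩, fun h => ⟨⟨h.1.le.trans h.2, h.2⟩, h.1⟩⟩
  have h4 := P.prob_inter_add_sdiff ((mE.inter mF).diff mL) mT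
  have e5 : (({ω : ℕ → ℝ | ω 0 ≤ a} ∩ {ω | ω 1 ≤ a}) \ {ω | ω 0 < ω 1}) \ {ω | ω 0 = ω 1} =
      {ω | ω 1 < ω 0 ∧ ω 0 ≤ a} := by
    ext ω
    exact ⟨fun h => ⟨lt_of_le_of_ne (not_lt.mp h.1.2) (Ne.symm h.2), h.1.1.1⟩,
      fun h => ⟨⟨⟨h.2, h.1.le.trans h.2⟩, h.1.not_gt⟩, h.1.ne'⟩⟩
  have h5 := P.prob_mono (((mE.inter mF).diff mL).inter mT) mT inter_subset_right
  have h6 := P.prob_nonneg (((mE.inter mF).diff mL).inter mT)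
  rw [prob_tie hexch hs hbridge] at h5
  rw [e3] at h2
  rw [e4] at h3
  rw [e5, hswapz] at h4
  linarith

/-! ### The partition -/

/-- A countable cover of the sequence space, indexed by a sequence `q` of real numbers with dense
range. Inside `{Y₁ < Y₂}` the `m`-th set consists of the sequences whose initial increasing run has
at most `m + 2` terms, or is infinite; outside, of the sequences with `Y₁ = Y₂` or with
`Y₂ ≤ q m < Y₁`. -/
def runCover (q : ℕ → ℝ) (m : ℕ) : Set (ℕ → ℝ) :=
  (increasingRun 1 \ increasingRun (m + 2)) ∪ (⋂ n, increasingRun n) ∪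
    ({ω | ω 0 = ω 1} ∪ {ω | ω 1 ≤ q m ∧ q m < ω 0})

theorem measurableSet_descent_through (a : ℝ) :
    MeasurableSet {ω : ℕ → ℝ | ω 1 ≤ a ∧ a < ω 0} :=
  (measurableSet_le (measurable_pi_apply 1) measurable_const).inter
    (measurableSet_lt measurable_const (measurable_pi_apply 0))

theorem measurableSet_runCover (q : ℕ → ℝ) (m : ℕ) : MeasurableSet (runCover q m) :=
  (((measurableSet_increasingRun 1).diff (measurableSet_increasingRun _)).union
    (.iInter measurableSet_increasingRun)).union
    ((measurableSet_eq_fun (measurable_pi_apply 0) (measurable_pi_apply 1)).union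
      (measurableSet_descent_through _))

theorem iUnion_runCover {q : ℕ → ℝ} (hq : DenseRange q) : ⋃ m, runCover q m = univ := by
  refine eq_univ_of_forall fun ω => mem_iUnion.mpr ?_
  rcases lt_trichotomy (ω 0) (ω 1) with h | h | h
  · have hω : ω ∈ increasingRun 1 := by rwa [increasingRun_one]
    by_cases hinf : ω ∈ ⋂ n, increasingRun n
    · exact ⟨0, .inl (.inr hinf)⟩
    · obtain ⟨n, hn⟩ := not_forall.mp (mt mem_iInter.mpr hinf)
      exact ⟨n, .inl (.inl ⟨hω, fun h' => hn (increasingRun_anti (by omega) h')⟩)⟩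
  · exact ⟨0, .inr (.inl h)⟩
  · obtain ⟨m, hm⟩ := hq.exists_mem_open isOpen_Ioo (nonempty_Ioo.mpr h)
    exact ⟨m, .inr (.inr ⟨hm.1.le, hm.2⟩)⟩

theorem isCountablePartition_disjointed_runCover {q : ℕ → ℝ} (hq : DenseRange q) :
    IsCountablePartition (disjointed (runCover q)) where
  measurable := MeasurableSet.disjointed (measurableSet_runCover q)
  disjoint _ _ h := disjoint_disjointed (runCover q) h
  cover := by rw [iUnion_disjointed, iUnion_runCover hq]

/-- The `m`-th cell contains the event that the initial run has exactly `m + 2` terms. -/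
theorem increasingRun_sdiff_subset_disjointed (q : ℕ → ℝ) (m : ℕ) :
    increasingRun (m + 1) \ increasingRun (m + 2) ⊆ disjointed (runCover q) m := by
  rintro ω ⟨h1, h2⟩
  have h3 : ω ∈ increasingRun 1 := increasingRun_anti (by omega) h1
  have h4 : ω 0 < ω 1 := by rwa [increasingRun_one] at h3
  rw [disjointed_eq_inter_compl]
  refine ⟨.inl (.inl ⟨h3, h2⟩), mem_iInter₂.mpr fun j hj => ?_⟩
  rintro ((h | h) | h | h)
  · exact h.2 (increasingRun_anti (by omega) h1)
  · exact h2 (mem_iInter.mp h _)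
  · exact h4.ne h
  · exact h4.not_ge (h.1.trans h.2.le)

theorem disjointed_runCover_sdiff_subset (q : ℕ → ℝ) (m : ℕ) :
    disjointed (runCover q) m \ increasingRun 1 ⊆
      {ω | ω 0 = ω 1} ∪ {ω | ω 1 ≤ q m ∧ q m < ω 0} := by
  rintro ω ⟨h1, h2⟩
  rcases disjointed_subset (runCover q) m h1 with (h | h) | h
  · exact absurd h.1 h2
  · exact absurd (mem_iInter.mp h 1) h2
  · exact h

end FullCondProb

open FullCondProb in
theorem mainTheorem2 (P : FullCondProb (ℕ → ℝ)) (hexch : P.Exchangeable)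
    (s : ℝ → ℝ) (hs : StrictMono s)
    (hbridge : ∀ n : ℕ, 1 ≤ n → P.AgreesWithBridgedConformal s n) :
    ∃ (B : Set (ℕ → ℝ)) (A : ℕ → Set (ℕ → ℝ)),
      MeasurableSet B ∧ IsCountablePartition A ∧ (∀ m, 0 < P.prob (A m)) ∧
      P.prob B < (⨅ m, P.cond B (A m)) ∧
      ¬ P.ConglomerableAlong A ∧
      P.DutchBookAlong A := by
  obtain ⟨q, hq⟩ := TopologicalSpace.exists_dense_seq ℝ
  have hB : MeasurableSet (increasingRun 1) := measurableSet_increasingRun 1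
  have hA := isCountablePartition_disjointed_runCover hq
  have hPB : P.prob (increasingRun 1) = 1 / 2 := by
    rw [increasingRun_one, prob_ascent hs hbridge]
  have hpos : ∀ m, 0 < P.prob (disjointed (runCover q) m) := fun m =>
    (prob_increasingRun_sdiff_pos hs hbridge (m + 1)).trans_le <|
      P.prob_mono ((measurableSet_increasingRun _).diff (measurableSet_increasingRun _))
        (hA.measurable m) (increasingRun_sdiff_subset_disjointed q m)
  have hcond : ∀ m, P.cond (increasingRun 1) (disjointed (runCover q) m) = 1 := by
    intro m
    refine P.cond_eq_one_of_prob_sdiff_eq_zero hB (hA.measurable m) (hpos m) ?_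
    have mT : MeasurableSet {ω : ℕ → ℝ | ω 0 = ω 1} :=
      measurableSet_eq_fun (measurable_pi_apply 0) (measurable_pi_apply 1)
    have mD := measurableSet_descent_through (q m)
    have hdisj : Disjoint {ω : ℕ → ℝ | ω 0 = ω 1} {ω | ω 1 ≤ q m ∧ q m < ω 0} :=
      disjoint_left.mpr fun ω (h : ω 0 = ω 1) h' => (h'.1.trans_lt h'.2).ne' h
    have h1 := P.prob_mono ((hA.measurable m).diff hB) (mT.union mD)
      (disjointed_runCover_sdiff_subset q m)
    rw [P.prob_union mT mD hdisj, prob_tie hexch hs hbridge,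
      prob_separated hexch hs hbridge, add_zero] at h1
    exact le_antisymm h1 (P.prob_nonneg ((hA.measurable m).diff hB))
  have hlt : P.prob (increasingRun 1) <
      ⨅ m, P.cond (increasingRun 1) (disjointed (runCover q) m) := by
    simp only [hcond, ciInf_const, hPB]
    norm_num
  exact ⟨increasingRun 1, disjointed (runCover q), hB, hA, hpos, hlt,
    fun h => hlt.not_ge (h _ hB).1,
    P.dutchBookAlong_of_cond_eq_one hB hA (fun m => P.nonempty_of_prob_pos (hpos m)) hPB hcond⟩
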